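/- Let $\Lambda$ be a nonempty finite set of labels. Consider finite, simple, undirected, connected graphs on a node set $V=\{0,\dots,n-1\}$ with $n\ge 2$, totally ordered by the usual order $<$ and with nodes labeled by elements of $\Lambda$. First-order logic over such graphs has node variables and function variables, terms $t ::= x \mid f(t)$, and formulas $\varphi ::= \mathrm{lab}_a(t) \mid s<t \mid s\sim t \mid \neg\varphi \mid \varphi\vee\varphi \mid \exists x\,\varphi$, where $\mathrm{lab}_a(t)$ says that node $t$ has label $a\in\Lambda$ and $s\sim t$ says that $s$ and $t$ are adjacent. *Monadic second-order logic* (MSO) extends it by atoms $t\in X$ and quantifiers $\exists X\,\varphi$ over sets $X$ of nodes. *Functional fixpoint logic* (FFL) extends first-order logic by formulas $\mathrm{PFP}[f_i := \varphi_i]_{1\le i\le \ell}\,\psi$, where $f_1,\dots,f_\ell$ are distinct function variables. This formula means that $\psi$ holds when $(f_1,\dots,f_\ell)$ is interpreted as $(f_1^\infty,\dots,f_\ell^\infty)$, which is defined as follows. Put $f_i^0=\mathrm{id}_V$, and let $f_i^{k+1}(u)$ be the unique $v\in V$ such that $\varphi_i$ holds with the functions $f_1^k,\dots,f_\ell^k$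 and with two special node variables, $\mathrm{in}$ and $\mathrm{out}$, interpreted as $u$ and $v$; if there is no such $v$ or more than one, put $f_i^{k+1}(u)=u$. If there is a $k$ with $f_i^k=f_i^{k+1}$ for all $i$, then $f_i^\infty=f_i^k$; otherwise $f_i^\infty=\mathrm{id}_V$. The operator binds $f_1,\dots,f_\ell$ in all $\varphi_i$ and in $\psi$, and binds $\mathrm{in},\mathrm{out}$ in the $\varphi_i$ only. A set of labeled graphs is *definable* in a logic if it is the set of all labeled graphs that satisfy some formula of the logic without free variables. Then FFL is strictly more expressive than MSO on these graphs: every set of $\Lambda$-labeled graphs definable in MSO is definable in FFL, and some set of $\Lambda$-labeled graphs is definable in FFL but not in MSO. Specifically, Hamiltonicity (the set of all labeled graphs whose underlying graph has a cycle that passes through each node exactly once) is definable in FFL but not in MSO. -/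

import Mathlib

namespace FunctionalFixpoint

/-- A finite, simple, undirected, connected graph on the node set `{0, …, n-1}` with `n ≥ 2`,
totally ordered by the usual order of the integers, whose nodes carry labels in `Λ`. -/
structure LabeledGraph (Λ : Type*) where
  /-- the number of nodes -/
  n : ℕ
  two_le : 2 ≤ n
  graph : SimpleGraph (Fin n)
  connected : graph.Connected
  label : Fin n → Λ

/-- The set of nodes. -/
abbrev LabeledGraph.Node {Λ : Type*} (G : LabeledGraph Λ) : Type := Fin G.n

/-- Node variables (an infinite supply). -/
abbrev NodeVar : Type := ℕ

/-- Function variables (an infinite supply). -/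
abbrev FuncVar : Type := ℕ

/-- Set variables (an infinite supply). -/
abbrev SetVar : Type := ℕ

/-- The special node variable that stands for the input value in a function definition. -/
def inVar : NodeVar := 0

/-- The special node variable that stands for the output value in a function definition. -/
def outVar : NodeVar := 1

/-! ### Functional fixpoint logic -/

/-- Terms: `x` or `f(t)`. -/
inductive Term : Type where
  | var (x : NodeVar) : Term
  | app (f : FuncVar) (t : Term) : Term

namespace Term

/-- Free node variables of a term. -/
def freeNode : Term → Set NodeVar
  | var x => {x}
  | app _ t => t.freeNode

/-- Free function variables of a term. -/
def freeFunc : Term → Set FuncVar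
  | var _ => ∅
  | app f t => insert f t.freeFunc

end Term

/-- Formulas of functional fixpoint logic: first-order logic together with the partial fixpoint
operator `PFP [f₁ := φ₁, …, f_ℓ := φ_ℓ] ψ`, where `f₁, …, f_ℓ` are distinct function variables. -/
inductive FFL (Λ : Type*) where
  | labeled (a : Λ) (t : Term) : FFL Λ
  | smaller (s t : Term) : FFL Λ
  | linked (s t : Term) : FFL Λ
  | not (φ : FFL Λ) : FFL Λ
  | or (φ ψ : FFL Λ) : FFL Λ
  | exNode (x : NodeVar) (φ : FFL Λ) : FFL Λ
  | pfp {l : ℕ} (f : Fin l ↪ FuncVar) (φ : Fin l → FFL Λ) (ψ : FFL Λ) : FFL Λ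

/-- An assignment of nodes to node variables and of functions on nodes to function variables. -/
structure Assignment (V : Type*) where
  node : NodeVar → V
  func : FuncVar → V → V

namespace Assignment

variable {V : Type*}

/-- `α[x ↦ v]`. -/
def setNode (α : Assignment V) (x : NodeVar) (v : V) : Assignment V :=
  { α with node := Function.update α.node x v }

/-- `α[fᵢ ↦ gᵢ]` for all `i`. -/
noncomputable def setFuncs (α : Assignment V) {l : ℕ} (f : Fin l ↪ FuncVar)
    (g : Fin l → V → V) : Assignment V :=
  { α with func := Function.extend f g α.func }

end Assignment

/-- The value of a term. -/
def Term.eval {V : Type*} (α : Assignment V) : Term → V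
  | .var x => α.node x
  | .app f t => α.func f (t.eval α)

open Classical in
/-- The function induced by a relation `R`: it maps `u` to the unique `v` with `R u v` if there is
exactly one such `v`, and to `u` itself otherwise. -/
noncomputable def inducedFunc {V : Type*} (R : V → V → Prop) (u : V) : V :=
  if h : ∃! v, R u v then h.choose else u

/-- The stages of the induction: start with identity functions and iterate the operator `F`. -/
def stage {V : Type*} {l : ℕ} (F : (Fin l → V → V) → (Fin l → V → V)) (k : ℕ) : Fin l → V → V :=
  F^[k] (fun _ => id)

open Classical in
/-- The partial fixpoint: the fixpoint that the stages reach, if there is one, and the tuple of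
identity functions otherwise. -/
noncomputable def partialFixpoint {V : Type*} {l : ℕ} (F : (Fin l → V → V) → (Fin l → V → V)) :
    Fin l → V → V :=
  if h : ∃ k, stage F k = stage F (k + 1) then stage F (Nat.find h) else fun _ => id

namespace FFL

variable {Λ : Type*}

/-- Free node variables. The operator `pfp` binds the input and output variables in the defining
formulas, but not in the main formula. -/
def freeNode : FFL Λ → Set NodeVar
  | labeled _ t => t.freeNode
  | smaller s t => s.freeNode ∪ t.freeNode
  | linked s t => s.freeNode ∪ t.freeNode
  | not φ => φ.freeNode
  | or φ ψ => φ.freeNode ∪ ψ.freeNode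
  | exNode x φ => φ.freeNode \ {x}
  | pfp _ φ ψ => (⋃ i, ((φ i).freeNode \ {inVar, outVar})) ∪ ψ.freeNode

/-- Free function variables. -/
def freeFunc : FFL Λ → Set FuncVar
  | labeled _ t => t.freeFunc
  | smaller s t => s.freeFunc ∪ t.freeFunc
  | linked s t => s.freeFunc ∪ t.freeFunc
  | not φ => φ.freeFunc
  | or φ ψ => φ.freeFunc ∪ ψ.freeFunc
  | exNode _ φ => φ.freeFunc
  | pfp f φ ψ => (⋃ i, ((φ i).freeFunc \ Set.range f)) ∪ (ψ.freeFunc \ Set.range f)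

/-- Satisfaction of a formula under an assignment. -/
def Sat (G : LabeledGraph Λ) : FFL Λ → Assignment G.Node → Prop
  | labeled a t, α => G.label (t.eval α) = a
  | smaller s t, α => s.eval α < t.eval α
  | linked s t, α => G.graph.Adj (s.eval α) (t.eval α)
  | not φ, α => ¬ Sat G φ α
  | or φ ψ, α => Sat G φ α ∨ Sat G ψ α
  | exNode x φ, α => ∃ v, Sat G φ (α.setNode x v)
  | pfp f φ ψ, α =>
      Sat G ψ (α.setFuncs f (partialFixpoint fun g i =>
        inducedFunc fun u v =>
          Sat G (φ i) (((α.setFuncs f g).setNode inVar u).setNode outVar v)))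

/-- A sentence is a formula without free variables. -/
def IsSentence (φ : FFL Λ) : Prop := φ.freeNode = ∅ ∧ φ.freeFunc = ∅

/-- The property `P` of labeled graphs is defined by some sentence of functional fixpoint logic.
(The truth value of a sentence does not depend on the assignment.) -/
def Definable (P : Set (LabeledGraph Λ)) : Prop :=
  ∃ φ : FFL Λ, φ.IsSentence ∧ P = {G | ∀ α : Assignment G.Node, φ.Sat G α}

end FFL

/-! ### Monadic second-order logic -/

/-- Formulas of monadic second-order logic over ordered labeled graphs: first-order logic with
set variables and quantification over sets of nodes. There are no function quantifiers, so sentences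
have no function variables, and the terms are just the node variables. -/
inductive MSO (Λ : Type*) where
  | labeled (a : Λ) (x : NodeVar) : MSO Λ
  | smaller (x y : NodeVar) : MSO Λ
  | linked (x y : NodeVar) : MSO Λ
  | mem (x : NodeVar) (X : SetVar) : MSO Λ
  | not (φ : MSO Λ) : MSO Λ
  | or (φ ψ : MSO Λ) : MSO Λ
  | exNode (x : NodeVar) (φ : MSO Λ) : MSO Λ
  | exSet (X : SetVar) (φ : MSO Λ) : MSO Λ

namespace MSO

variable {Λ : Type*}

/-- Free node variables. -/
def freeNode : MSO Λ → Set NodeVar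
  | labeled _ x => {x}
  | smaller x y => {x, y}
  | linked x y => {x, y}
  | mem x _ => {x}
  | not φ => φ.freeNode
  | or φ ψ => φ.freeNode ∪ ψ.freeNode
  | exNode x φ => φ.freeNode \ {x}
  | exSet _ φ => φ.freeNode

/-- Free set variables. -/
def freeSet : MSO Λ → Set SetVar
  | labeled _ _ => ∅
  | smaller _ _ => ∅
  | linked _ _ => ∅
  | mem _ X => {X}
  | not φ => φ.freeSet
  | or φ ψ => φ.freeSet ∪ ψ.freeSet
  | exNode _ φ => φ.freeSet
  | exSet X φ => φ.freeSet \ {X}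

/-- Satisfaction of a formula, where `ν` interprets the node variables and `σ` the set
variables. -/
def Sat (G : LabeledGraph Λ) : MSO Λ → (NodeVar → G.Node) → (SetVar → Set G.Node) → Prop
  | labeled a x, ν, _ => G.label (ν x) = a
  | smaller x y, ν, _ => ν x < ν y
  | linked x y, ν, _ => G.graph.Adj (ν x) (ν y)
  | mem x X, ν, σ => ν x ∈ σ X
  | not φ, ν, σ => ¬ Sat G φ ν σ
  | or φ ψ, ν, σ => Sat G φ ν σ ∨ Sat G ψ ν σ
  | exNode x φ, ν, σ => ∃ v, Sat G φ (Function.update ν x v) σ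
  | exSet X φ, ν, σ => ∃ S : Set G.Node, Sat G φ ν (Function.update σ X S)

/-- A sentence is a formula without free variables. -/
def IsSentence (φ : MSO Λ) : Prop := φ.freeNode = ∅ ∧ φ.freeSet = ∅

/-- The property `P` of labeled graphs is defined by some sentence of monadic second-order logic.
(The truth value of a sentence does not depend on the assignment.) -/
def Definable (P : Set (LabeledGraph Λ)) : Prop :=
  ∃ φ : MSO Λ, φ.IsSentence ∧
    P = {G | ∀ (ν : NodeVar → G.Node) (σ : SetVar → Set G.Node), φ.Sat G ν σ}

end MSO

/-- Hamiltonicity: the underlying graph has a cycle through each node exactly once. -/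
def hamiltonicity (Λ : Type*) : Set (LabeledGraph Λ) := {G | G.graph.IsHamiltonian}

end FunctionalFixpoint

/-! Inclusion. Functional fixpoint logic can quantify existentially over functions. The order makes
functions on the nodes into base-`n` numbers, and the successor of such a number is first-order
definable. A partial fixpoint starts at the identity, counts upwards cyclically through all
functions, and stands still once the current function satisfies `φ`. Since `n ≥ 2`, counting never
stands still by itself. Hence, if a witness exists, the limit is one; otherwise `φ` fails at every
function, the limit included, whatever default it takes. This is `FFL.sat_exFunc`, based on
`partialFixpoint_search`. Set quantifiers reduce to function quantifiers: a set is coded as the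
non-fixed nodes of a function.

Hamiltonicity. For `n ≥ 3` it says that some injective `f` has `f i` adjacent to `f (i + 1)` for all
`i`, cyclically; this is one function quantifier.

Strictness. A complete bipartite graph with parts of at least two nodes is Hamiltonian iff the parts
have equal size. By a composition argument (`LeftAssignment.exists_finite_type`), an MSO formula
sees the first part only through one of finitely many types. Two first parts of different sizes
share a type, and exchanging them turns a balanced graph into an unbalanced one without changing the
truth value. -/

namespace FunctionalFixpoint

/-! ### Counting through all functions -/

/-- The successor of `f`, read as a number in base `n` with least significant digit first; the
largest number is sent to `0`. -/
def odometer {k n : ℕ} [NeZero n] (f : Fin k → Fin n) (u : Fin k) : Fin n :=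
  if ∀ w < u, (f w : ℕ) + 1 = n then f u + 1 else f u

lemma odometer_zero {k n : ℕ} [NeZero n] (f : Fin (k + 1) → Fin n) :
    odometer f 0 = f 0 + 1 := by
  simp [odometer]

lemma odometer_succ {k n : ℕ} [NeZero n] (f : Fin (k + 1) → Fin n) (u : Fin k) :
    odometer f u.succ =
      if (f 0 : ℕ) + 1 = n then odometer (fun i => f i.succ) u else f u.succ := by
  by_cases h : (f 0 : ℕ) + 1 = n <;> simp [odometer, Fin.forall_fin_succ, h]

/-- A congruence, since the largest number overflows to `0`. In the induction the least significant
digit is split off; it carries exactly when it equals `n - 1`. -/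
lemma finFunctionFinEquiv_odometer {k n : ℕ} [NeZero n] (f : Fin k → Fin n) :
    (finFunctionFinEquiv (odometer f) : ℕ) ≡ finFunctionFinEquiv f + 1 [MOD n ^ k] := by
  induction k with
  | zero => simp [Nat.modEq_one]
  | succ k ih =>
    have key (g : Fin (k + 1) → Fin n) : (finFunctionFinEquiv g : ℕ) =
        g 0 + n * finFunctionFinEquiv fun i => g i.succ := by
      simp only [finFunctionFinEquiv_apply, Fin.sum_univ_succ, Finset.mul_sum]
      simp only [Fin.val_zero, pow_zero, mul_one, Fin.val_succ, pow_succ]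
      congr 1
      exact Finset.sum_congr rfl fun i _ => by ring
    have hval : ((f 0 + 1 : Fin n) : ℕ) = ((f 0 : ℕ) + 1) % n := by
      simp [Fin.val_add]
    rw [key, key f, odometer_zero, hval]
    simp only [odometer_succ]
    by_cases h : (f 0 : ℕ) + 1 = n
    · simp only [h, if_true, Nat.mod_self, zero_add]
      have := Nat.ModEq.mul_left' n (ih fun i => f i.succ)
      rw [← pow_succ', mul_add, mul_one] at this
      have e : (f 0 : ℕ) + n * (finFunctionFinEquiv fun i => f i.succ) + 1 =
          n * (finFunctionFinEquiv fun i => f i.succ) + n := by omega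
      rw [e]
      exact this
    · have hlt : (f 0 : ℕ) + 1 < n := by have := (f 0).isLt; omega
      simp only [h, if_false, Nat.mod_eq_of_lt hlt]
      exact congrArg (· % _) (by omega)

lemma finFunctionFinEquiv_iterate_odometer {k n : ℕ} [NeZero n] (f : Fin k → Fin n) (j : ℕ) :
    (finFunctionFinEquiv (odometer^[j] f) : ℕ) ≡ finFunctionFinEquiv f + j [MOD n ^ k] := by
  induction j with
  | zero => rfl
  | succ j ih =>
    rw [Function.iterate_succ_apply']
    exact (finFunctionFinEquiv_odometer _).trans (ih.add_right 1)

/-- Counting reaches every function. -/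
lemma exists_iterate_odometer {k n : ℕ} [NeZero n] (f g : Fin k → Fin n) :
    ∃ j, odometer^[j] f = g := by
  -- Count up from `f` to the overflow at `n ^ k`, then from `0` to `g`.
  refine ⟨finFunctionFinEquiv g + (n ^ k - finFunctionFinEquiv f), ?_⟩
  apply finFunctionFinEquiv.injective
  apply Fin.ext
  have h := finFunctionFinEquiv_iterate_odometer f
    (finFunctionFinEquiv g + (n ^ k - finFunctionFinEquiv f))
  have hf := (finFunctionFinEquiv f).isLt
  have e : (finFunctionFinEquiv f : ℕ) + (finFunctionFinEquiv g + (n ^ k - finFunctionFinEquiv f))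
      = finFunctionFinEquiv g + n ^ k := by omega
  rw [e] at h
  exact Nat.ModEq.eq_of_lt_of_lt (h.trans (by simp [Nat.ModEq])) (Fin.isLt _) (Fin.isLt _)

/-- The digit at `0` has no digit below it and always changes; `n ≥ 2` makes `+ 1` a proper change.
-/
lemma odometer_ne {n : ℕ} (hn : 2 ≤ n) [NeZero n] (f : Fin n → Fin n) : odometer f ≠ f := by
  intro h
  have h0 := congrFun h ⟨0, by omega⟩
  have : Fact (1 < n) := ⟨by omega⟩
  simp [odometer] at h0
  omega

/-- Suppose that the orbit of the identities under a fixed-point free map `S` comprises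
everything. Iterating `S` until `P` holds leads to a partial fixpoint with the property `P`, unless
there is nothing with this property. -/
lemma partialFixpoint_search {V : Type*} {l : ℕ} (P : (Fin l → V → V) → Prop)
    (S F : (Fin l → V → V) → Fin l → V → V) (hP : ∀ g, P g → F g = g) (hS : ∀ g, ¬ P g → F g = S g)
    (hne : ∀ g, S g ≠ g) (horbit : ∀ g, ∃ k, S^[k] (fun _ => id) = g) :
    P (partialFixpoint F) ↔ ∃ g, P g := by
  -- One direction is trivial: the partial fixpoint itself is a witness.
  refine ⟨fun h => ⟨_, h⟩, fun ⟨g, hg⟩ => ?_⟩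
  have hstage (k : ℕ) : stage F (k + 1) = F (stage F k) := Function.iterate_succ_apply' _ _ _
  have hex : ∃ k, P (stage F k) := by
    -- If no stage had `P`, the stages would be the whole orbit of `S`, which contains `g`.
    by_contra! hno
    have (k : ℕ) : stage F k = S^[k] fun _ => id := by
      induction k with
      | zero => rfl
      | succ k ih => rw [hstage, hS _ (hno k), ih, Function.iterate_succ_apply']
    obtain ⟨k, rfl⟩ := horbit g
    exact hno k (this k ▸ hg)
  obtain ⟨k, hk⟩ := hex
  have hfix : ∃ k, stage F k = stage F (k + 1) := ⟨k, by rw [hstage, hP _ hk]⟩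
  classical
  -- The first stationary stage has `P`: otherwise `F` would act on it as `S`, which fixes nothing.
  have hfind : stage F (Nat.find hfix) = F (stage F (Nat.find hfix)) := by
    rw [← hstage]
    exact Nat.find_spec hfix
  rw [partialFixpoint, dif_pos hfix]
  by_contra hnot
  refine hne (stage F (Nat.find hfix)) ?_
  rw [← hS _ (by convert hnot)]
  exact hfind.symm

lemma inducedFunc_eq {V : Type*} (R : V → V → Prop) {u v : V} (h : ∀ w, R u w ↔ w = v) :
    inducedFunc R u = v := by
  have hex : ∃! w, R u w := ⟨v, (h v).2 rfl, fun w hw => (h w).1 hw⟩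
  rw [inducedFunc, dif_pos hex]
  exact (h _).1 hex.choose_spec.1

instance LabeledGraph.instNeZero {Λ : Type*} (G : LabeledGraph Λ) : NeZero G.n :=
  ⟨by have := G.two_le; omega⟩

instance LabeledGraph.instNontrivialNode {Λ : Type*} (G : LabeledGraph Λ) : Nontrivial G.Node :=
  Fin.nontrivial_iff_two_le.2 G.two_le

/-! ### Updates of assignments -/

namespace Assignment

variable {V : Type*}

/-- `α[f ↦ g]`. -/
def setFunc (α : Assignment V) (f : FuncVar) (g : V → V) : Assignment V :=
  { α with func := Function.update α.func f g }

@[simp] lemma node_setNode_self (α : Assignment V) (x : NodeVar) (v : V) :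
    (α.setNode x v).node x = v := by simp [setNode]

lemma node_setNode_of_ne (α : Assignment V) {x y : NodeVar} (h : y ≠ x) (v : V) :
    (α.setNode x v).node y = α.node y := by simp [setNode, h]

@[simp] lemma func_setNode (α : Assignment V) (x : NodeVar) (v : V) :
    (α.setNode x v).func = α.func := rfl

@[simp] lemma node_setFunc (α : Assignment V) (f : FuncVar) (g : V → V) :
    (α.setFunc f g).node = α.node := rfl

@[simp] lemma func_setFunc_self (α : Assignment V) (f : FuncVar) (g : V → V) :
    (α.setFunc f g).func f = g := by simp [setFunc]

lemma setFuncs_eq_setFunc (α : Assignment V) (e : Fin 1 ↪ FuncVar) (g : Fin 1 → V → V) :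
    α.setFuncs e g = α.setFunc (e 0) (g 0) := by
  unfold setFuncs setFunc
  congr 1
  funext x
  by_cases h : x = e 0
  · subst h
    rw [e.injective.extend_apply, Function.update_self]
  · rw [Function.update_of_ne h, Function.extend_apply']
    rintro ⟨i, rfl⟩
    exact h (by rw [Subsingleton.elim i 0])

end Assignment

lemma Term.eval_setNode {V : Type*} (α : Assignment V) {x : NodeVar} (v : V) (t : Term)
    (h : x ∉ t.freeNode) : t.eval (α.setNode x v) = t.eval α := by
  induction t with
  | var y => exact Assignment.node_setNode_of_ne _ (fun e => h (by simp [Term.freeNode, e])) _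
  | app f t ih => simp [Term.eval, ih h]

/-! ### Derived formulas of functional fixpoint logic -/

namespace FFL

variable {Λ : Type*}

/-- Conjunction. -/
def and (φ ψ : FFL Λ) : FFL Λ := not (or (not φ) (not ψ))

/-- If `χ`, then `φ`, else `ψ`. -/
def cond (χ φ ψ : FFL Λ) : FFL Λ := or (and χ φ) (and (not χ) ψ)

/-- Equality of terms. -/
def eq (s t : Term) : FFL Λ := not (or (smaller s t) (smaller t s))

/-- `t` is the largest node. -/
def isMax (t : Term) : FFL Λ := not (exNode 3 (smaller t (.var 3)))

/-- `t` is the smallest node. -/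
def isMin (t : Term) : FFL Λ := not (exNode 3 (smaller (.var 3) t))

/-- `t` is the cyclic successor of `s`. -/
def cyclicSucc (s t : Term) : FFL Λ :=
  or (and (smaller s t) (not (exNode 3 (and (smaller s (.var 3)) (smaller (.var 3) t)))))
    (and (isMax s) (isMin t))

/-- Every node below `in` is mapped to the largest node by `f`. -/
def carry (f : FuncVar) : FFL Λ :=
  not (exNode 2 (and (smaller (.var 2) (.var inVar)) (not (isMax (.app f (.var 2))))))

/-- `out` is the value at `in` of `f`, if `φ` holds, and of the odometer successor of `f`
otherwise. -/
def searchStep (f : FuncVar) (φ : FFL Λ) : FFL Λ :=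
  cond (or φ (not (carry f))) (eq (.var outVar) (.app f (.var inVar)))
    (cyclicSucc (.app f (.var inVar)) (.var outVar))

/-- The family that consists of one function variable. -/
def constEmbedding (f : FuncVar) : Fin 1 ↪ FuncVar :=
  ⟨fun _ => f, Function.injective_of_subsingleton _⟩

@[simp] lemma constEmbedding_apply (f : FuncVar) (i : Fin 1) : constEmbedding f i = f := rfl

/-- Quantification over functions. -/
def exFunc (f : FuncVar) (φ : FFL Λ) : FFL Λ :=
  pfp (constEmbedding f) (fun _ => searchStep f φ) φ

/-! ### Semantics of the derived formulas -/

variable {G : LabeledGraph Λ} {α : Assignment G.Node}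

@[simp] lemma sat_and {φ ψ : FFL Λ} : Sat G (and φ ψ) α ↔ Sat G φ α ∧ Sat G ψ α := by
  simp [and, Sat]

@[simp] lemma sat_cond {χ φ ψ : FFL Λ} :
    Sat G (cond χ φ ψ) α ↔ (Sat G χ α → Sat G φ α) ∧ (¬ Sat G χ α → Sat G ψ α) := by
  by_cases h : Sat G χ α <;> simp [cond, Sat, h]

@[simp] lemma sat_eq {s t : Term} : Sat G (eq s t) α ↔ s.eval α = t.eval α := by
  simp only [eq, Sat, not_or, not_lt]
  exact ⟨fun h => le_antisymm h.2 h.1, fun h => ⟨h.ge, h.le⟩⟩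

/-- The hypothesis on `3`, here and below, keeps the bound variable `3` from capturing a variable of
the term. -/
lemma sat_isMax {t : Term} (ht : 3 ∉ t.freeNode) :
    Sat G (isMax t) α ↔ (t.eval α).val + 1 = G.n := by
  simp only [isMax, Sat, Term.eval_setNode _ _ _ ht]
  simp only [Term.eval, Assignment.node_setNode_self, not_exists, not_lt]
  have := (t.eval α).isLt
  refine ⟨fun h => ?_, fun h v => ?_⟩
  · have := h ⟨G.n - 1, by omega⟩
    rw [Fin.le_def] at this
    simp only at this
    omega
  · rw [Fin.le_def]
    omega

lemma sat_isMin {t : Term} (ht : 3 ∉ t.freeNode) :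
    Sat G (isMin t) α ↔ (t.eval α).val = 0 := by
  simp only [isMin, Sat, Term.eval_setNode _ _ _ ht]
  simp only [Term.eval, Assignment.node_setNode_self, not_exists, not_lt]
  refine ⟨fun h => ?_, fun h v => ?_⟩
  · have := h 0
    rw [Fin.le_def] at this
    simpa using this
  · rw [Fin.le_def]
    omega

lemma sat_cyclicSucc {s t : Term} (hs : 3 ∉ s.freeNode) (ht : 3 ∉ t.freeNode) :
    Sat G (cyclicSucc s t) α ↔ t.eval α = s.eval α + 1 := by
  simp only [cyclicSucc, Sat, sat_and, sat_isMax hs, sat_isMin ht, Term.eval_setNode _ _ _ hs,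
    Term.eval_setNode _ _ _ ht]
  simp only [Term.eval, Assignment.node_setNode_self, not_exists, not_and, not_lt]
  generalize s.eval α = u
  generalize t.eval α = v
  have h2 := G.two_le
  have h1 : ((u + 1 : Fin G.n) : ℕ) = ((u : ℕ) + 1) % G.n := by
    simp [Fin.val_add]
  rw [Fin.ext_iff, h1]
  have hu := u.isLt
  have hv := v.isLt
  constructor
  · rintro (⟨huv, h⟩ | ⟨h, h'⟩)
    · rw [Fin.lt_def] at huv
      have := h ⟨u + 1, by omega⟩ (by simp [Fin.lt_def])
      rw [Fin.le_def] at this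
      simp only at this
      rw [Nat.mod_eq_of_lt] <;> omega
    · rw [h, Nat.mod_self, h']
  · intro h
    by_cases hlt : (u : ℕ) + 1 < G.n
    · rw [Nat.mod_eq_of_lt hlt] at h
      refine Or.inl ⟨by rw [Fin.lt_def]; omega, fun w hw => ?_⟩
      rw [Fin.lt_def] at hw
      rw [Fin.le_def]
      omega
    · have : (u : ℕ) + 1 = G.n := by omega
      rw [this, Nat.mod_self] at h
      exact Or.inr ⟨this, h⟩

lemma sat_carry {f : FuncVar} :
    Sat G (carry f) α ↔ ∀ w < α.node inVar, (α.func f w).val + 1 = G.n := by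
  have h : (3 : ℕ) ∉ (Term.app f (.var 2)).freeNode := by simp [Term.freeNode]
  have h' (w) : (α.setNode 2 w).node inVar = α.node inVar :=
    Assignment.node_setNode_of_ne _ (by decide) _
  simp [carry, Sat, sat_isMax h, Term.eval, h']

open Classical in
lemma sat_searchStep {f : FuncVar} {φ : FFL Λ} :
    Sat G (searchStep f φ) α ↔
      α.node outVar =
        (if Sat G φ α then α.func f else odometer (α.func f)) (α.node inVar) := by
  have h : (3 : ℕ) ∉ (Term.app f (.var inVar)).freeNode := by simp [Term.freeNode, inVar]
  have h' : (3 : ℕ) ∉ (Term.var outVar).freeNode := by simp [Term.freeNode, outVar]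
  have h1 : odometer (α.func f) (α.node inVar) = if Sat G (carry f) α then
      α.func f (α.node inVar) + 1 else α.func f (α.node inVar) := by
    simp only [sat_carry, odometer]
  by_cases hφ : Sat G φ α <;> by_cases hc : Sat G (carry f) α <;>
    simp [searchStep, Sat, sat_cyclicSucc h h', Term.eval, h1, hφ, hc]

/-- `φ` also occurs in the defining formula of the fixpoint, where `in` and `out` are bound; `hφ`
ensures that it means the same there. -/
lemma sat_exFunc {f : FuncVar} {φ : FFL Λ}
    (hφ : ∀ (β : Assignment G.Node) u v,
      Sat G φ ((β.setNode inVar u).setNode outVar v) ↔ Sat G φ β) :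
    Sat G (exFunc f φ) α ↔ ∃ g, Sat G φ (α.setFunc f g) := by
  classical
  simp only [exFunc, Sat, Assignment.setFuncs_eq_setFunc, constEmbedding_apply]
  -- One round of the induction keeps a witness and otherwise counts up by one.
  have hind (g : Fin 1 → G.Node → G.Node) (i : Fin 1) :
      (inducedFunc fun u v => Sat G (searchStep f φ)
        (((α.setFunc f (g 0)).setNode inVar u).setNode outVar v)) =
        if Sat G φ (α.setFunc f (g 0)) then g 0 else odometer (g 0) := by
    funext u
    apply inducedFunc_eq
    intro w
    have hin : (((α.setFunc f (g 0)).setNode inVar u).setNode outVar w).node inVar = u := by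
      rw [Assignment.node_setNode_of_ne _ (by decide), Assignment.node_setNode_self]
    rw [sat_searchStep, hφ, hin]
    simp
  have horbit (g : Fin 1 → G.Node → G.Node) :
      ∃ k, (fun (h : Fin 1 → G.Node → G.Node) (_ : Fin 1) => odometer (h 0))^[k]
        (fun _ => id) = g := by
    obtain ⟨k, hk⟩ := exists_iterate_odometer id (g 0)
    refine ⟨k, ?_⟩
    have (j : ℕ) : (fun (h : Fin 1 → G.Node → G.Node) (_ : Fin 1) => odometer (h 0))^[j]
        (fun _ => id) = fun _ => odometer^[j] id := by
      induction j with
      | zero => rfl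
      | succ j ih => rw [Function.iterate_succ_apply', ih, Function.iterate_succ_apply']
    rw [this, hk]
    funext i
    rw [Subsingleton.elim i 0]
  rw [partialFixpoint_search (fun g => Sat G φ (α.setFunc f (g 0)))
    (fun g _ => odometer (g 0)) _ ?_ ?_ ?_ horbit]
  · exact ⟨fun ⟨g, hg⟩ => ⟨g 0, hg⟩, fun ⟨g, hg⟩ => ⟨fun _ => g, hg⟩⟩
  · intro g hg
    funext i
    rw [hind g i, if_pos hg, Subsingleton.elim i 0]
  · intro g hg
    funext i
    rw [hind g i, if_neg hg]
  · intro g h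
    exact odometer_ne G.two_le _ (congrFun h 0)

lemma freeNode_exFunc (f : FuncVar) (φ : FFL Λ) : (exFunc f φ).freeNode = φ.freeNode := by
  ext x
  simp [exFunc, searchStep, cond, carry, cyclicSucc, isMax, isMin, and, eq, freeNode,
    Term.freeNode]
  tauto

lemma freeFunc_exFunc (f : FuncVar) (φ : FFL Λ) : (exFunc f φ).freeFunc = φ.freeFunc \ {f} := by
  ext x
  simp [exFunc, searchStep, cond, carry, cyclicSucc, isMax, isMin, and, eq, freeFunc,
    Term.freeFunc]
  tauto

end FFL

/-! ### From monadic second-order logic to functional fixpoint logic -/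

namespace MSO

variable {Λ : Type*}

/-- Translation into functional fixpoint logic. A set is represented by a function, as the set of
those nodes that are not fixed. Node variables are shifted, so that `in` and `out` are not used. -/
def toFFL : MSO Λ → FFL Λ
  | labeled a x => .labeled a (.var (x + 2))
  | smaller x y => .smaller (.var (x + 2)) (.var (y + 2))
  | linked x y => .linked (.var (x + 2)) (.var (y + 2))
  | mem x X => .not (.eq (.app X (.var (x + 2))) (.var (x + 2)))
  | not φ => .not φ.toFFL
  | or φ ψ => .or φ.toFFL ψ.toFFL
  | exNode x φ => .exNode (x + 2) φ.toFFL
  | exSet X φ => .exFunc X φ.toFFL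

/-- With at least two nodes, each node of `S` can be moved to a different node while all others stay
fixed. -/
lemma exists_support_eq {V : Type*} [Nontrivial V] (S : Set V) :
    ∃ g : V → V, {v | g v ≠ v} = S := by
  classical
  choose h hh using fun v : V => exists_ne v
  refine ⟨fun v => if v ∈ S then h v else v, ?_⟩
  ext v
  by_cases hv : v ∈ S <;> simp [hv, hh]

lemma sat_toFFL {G : LabeledGraph Λ} (φ : MSO Λ) (α : Assignment G.Node) :
    φ.toFFL.Sat G α ↔ φ.Sat G (fun x => α.node (x + 2)) fun X => {v | α.func X v ≠ v} := by
  induction φ generalizing α with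
  | labeled a x => rfl
  | smaller x y => rfl
  | linked x y => rfl
  | mem x X => simp [toFFL, FFL.Sat, Sat, Term.eval]
  | not φ ih => simp [toFFL, FFL.Sat, Sat, ih]
  | or φ ψ ih ih' => simp [toFFL, FFL.Sat, Sat, ih, ih']
  | exNode x φ ih =>
    simp only [toFFL, FFL.Sat, Sat, ih]
    refine exists_congr fun v => ?_
    rw [Assignment.func_setNode]
    have : (fun y => (α.setNode (x + 2) v).node (y + 2)) =
        Function.update (fun y => α.node (y + 2)) x v := by
      funext y
      by_cases h : y = x <;> simp [Assignment.setNode, h]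
    rw [this]
  | exSet X φ ih =>
    rw [toFFL, FFL.sat_exFunc]
    · simp only [ih, Sat, Assignment.node_setFunc]
      have (g : G.Node → G.Node) : (fun Y => {v | (α.setFunc X g).func Y v ≠ v}) =
          Function.update (fun Y => {v | α.func Y v ≠ v}) X {v | g v ≠ v} := by
        funext Y
        by_cases h : Y = X
        · subst h
          simp
        · simp [Assignment.setFunc, h]
      simp only [this]
      refine ⟨fun ⟨g, hg⟩ => ⟨_, hg⟩, fun ⟨S, hS⟩ => ?_⟩
      obtain ⟨g, rfl⟩ := exists_support_eq S
      exact ⟨g, hS⟩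
    · intro β u v
      -- A translated formula reads only variables of the form `x + 2`, hence neither `in` nor
      -- `out`.
      exact (ih _).trans (ih β).symm

lemma freeNode_toFFL (φ : MSO Λ) : φ.toFFL.freeNode ⊆ (· + 2) '' φ.freeNode := by
  induction φ with
  | exNode x φ ih =>
    rintro _ ⟨hy, hx⟩
    obtain ⟨y, hy', rfl⟩ := ih hy
    exact ⟨y, ⟨hy', fun e => hx (congrArg (· + 2) e)⟩, rfl⟩
  | exSet X φ ih => rwa [toFFL, FFL.freeNode_exFunc]
  | or φ ψ ih ih' =>
    rw [freeNode, Set.image_union]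
    exact Set.union_subset_union ih ih'
  | not φ ih => exact ih
  | _ => simp [toFFL, FFL.freeNode, FFL.eq, Term.freeNode, freeNode, Set.insert_subset_iff]

lemma freeFunc_toFFL (φ : MSO Λ) : φ.toFFL.freeFunc ⊆ φ.freeSet := by
  induction φ with
  | exNode x φ ih => exact ih
  | exSet X φ ih =>
    rw [toFFL, FFL.freeFunc_exFunc]
    exact Set.sdiff_subset_sdiff_left ih
  | or φ ψ ih ih' => exact Set.union_subset_union ih ih'
  | not φ ih => exact ih
  | _ => simp [toFFL, FFL.freeFunc, FFL.eq, Term.freeFunc, freeSet]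

lemma Definable.ffl {P : Set (LabeledGraph Λ)} (h : Definable P) : FFL.Definable P := by
  obtain ⟨φ, ⟨hn, hs⟩, rfl⟩ := h
  refine ⟨φ.toFFL, ⟨?_, ?_⟩, ?_⟩
  · exact Set.subset_empty_iff.1 (by simpa [hn] using freeNode_toFFL φ)
  · exact Set.subset_empty_iff.1 (by simpa [hs] using freeFunc_toFFL φ)
  · ext G
    refine ⟨fun h α => (sat_toFFL φ α).2 (h _ _), fun h ν σ => ?_⟩
    choose g hg using fun X => exists_support_eq (σ X)
    -- The shift by `-2` cancels the shift of the translation, and `g` codes the sets `σ`.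
    have := (sat_toFFL φ ⟨fun x => ν (x - 2), g⟩).1 (h _)
    simpa [hg] using this

end MSO

/-! ### Hamiltonicity in functional fixpoint logic -/

/-- A graph on `{0, …, n-1}` is Hamiltonian iff `n ≥ 3` and its nodes can be arranged in a circle
such that neighbours in the circle are adjacent. -/
lemma isHamiltonian_iff {n : ℕ} [NeZero n] (hn : n ≠ 1) (G : SimpleGraph (Fin n)) :
    G.IsHamiltonian ↔
      2 < n ∧ ∃ p : Fin n → Fin n, p.Injective ∧ ∀ i, G.Adj (p i) (p (i + 1)) := by
  -- By convention a graph with a single node is Hamiltonian; `hn` excludes it.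
  have h1 : G.IsHamiltonian ↔ ∃ a, ∃ p : G.Walk a a, p.IsCycle ∧ p.length = n := by
    simp [SimpleGraph.IsHamiltonian, SimpleGraph.Walk.isHamiltonianCycle_iff_isCycle_and_length_eq,
      hn]
  have key (h2 : 2 < n) (i j : Fin n) :
      (SimpleGraph.cycleGraph n).Adj i j ↔ j = i + 1 ∨ i = j + 1 := by
    obtain ⟨m, rfl⟩ : ∃ m, n = m + 2 := ⟨n - 2, by omega⟩
    rw [SimpleGraph.cycleGraph_adj, sub_eq_iff_eq_add', sub_eq_iff_eq_add', or_comm,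
      add_comm i, add_comm j, add_comm 1, add_comm 1]
  by_cases h2 : 2 < n
  · rw [h1, ← SimpleGraph.cycleGraph_isContained_iff h2]
    simp only [h2, true_and]
    constructor
    · rintro ⟨f⟩
      exact ⟨f, f.injective, fun i => f.toHom.map_adj ((key h2 _ _).2 (Or.inl rfl))⟩
    · rintro ⟨p, hp, hadj⟩
      refine ⟨⟨⟨p, fun {i j} hij => ?_⟩, hp⟩⟩
      rcases (key h2 _ _).1 hij with rfl | rfl
      · exact hadj i
      · exact (hadj j).symm
  -- On two adjacent nodes every bijection is a circular arrangement, but there is no cycle. Hence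
  -- the separate condition `2 < n`.
  · rw [h1]
    simp only [h2, false_and, iff_false]
    rintro ⟨a, p, hp, hl⟩
    have := hp.three_le_length
    omega

namespace FFL

variable {Λ : Type*}

/-- The function variable `0` denotes an arrangement of the nodes in a circle such that neighbours
in the circle are adjacent. -/
def circularArrangement : FFL Λ :=
  and (not (exNode 5 (exNode 6 (and (smaller (.var 5) (.var 6))
      (eq (.app 0 (.var 5)) (.app 0 (.var 6)))))))
    (not (exNode 5 (exNode 6 (and (cyclicSucc (.var 5) (.var 6))
      (not (linked (.app 0 (.var 5)) (.app 0 (.var 6))))))))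

/-- There are three nodes. -/
def threeNodes : FFL Λ :=
  exNode 2 (exNode 3 (exNode 4 (and (smaller (.var 2) (.var 3)) (smaller (.var 3) (.var 4)))))

lemma sat_threeNodes {G : LabeledGraph Λ} {α : Assignment G.Node} :
    Sat G threeNodes α ↔ 2 < G.n := by
  simp only [threeNodes, Sat, sat_and, Term.eval, Assignment.setNode, Fin.lt_def]
  simp
  constructor
  · rintro ⟨u, v, huv, w, hvw⟩
    have := w.isLt
    omega
  · intro h
    exact ⟨⟨0, by omega⟩, ⟨1, by omega⟩, by simp [Fin.lt_def], ⟨2, by omega⟩, by simp [Fin.lt_def]⟩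

lemma sat_circularArrangement {G : LabeledGraph Λ} {α : Assignment G.Node} :
    Sat G circularArrangement α ↔
      (α.func 0).Injective ∧ ∀ i, G.graph.Adj (α.func 0 i) (α.func 0 (i + 1)) := by
  have h5 : (3 : ℕ) ∉ (Term.var 5).freeNode := by simp [Term.freeNode]
  have h6 : (3 : ℕ) ∉ (Term.var 6).freeNode := by simp [Term.freeNode]
  simp only [circularArrangement, sat_and, Sat, sat_eq, sat_cyclicSucc h5 h6, Term.eval,
    Assignment.setNode]
  simp only [Function.update_self, ne_eq, Nat.reduceEqDiff, not_false_eq_true,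
    Function.update_of_ne, not_exists, not_and, not_not]
  refine and_congr ⟨fun h u v huv => ?_, fun h u v huv e => huv.ne (h e)⟩
    ⟨fun h i => h i _ rfl, fun h i j hj => hj ▸ h i⟩
  -- The formula tests injectivity only on pairs `u < v`, which suffices by symmetry.
  by_contra hne
  rcases lt_or_gt_of_ne hne with hlt | hlt
  · exact h u v hlt huv
  · exact h v u hlt huv.symm

lemma definable_hamiltonicity : Definable (hamiltonicity Λ) := by
  refine ⟨and threeNodes (exFunc 0 circularArrangement), ⟨?_, ?_⟩, ?_⟩
  · rw [and, freeNode, freeNode, freeNode, freeNode, freeNode_exFunc]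
    ext x
    simp [threeNodes, circularArrangement, cyclicSucc, isMax, isMin, and, eq, freeNode,
      Term.freeNode]
    tauto
  · rw [and, freeFunc, freeFunc, freeFunc, freeFunc, freeFunc_exFunc]
    ext x
    simp [threeNodes, circularArrangement, cyclicSucc, isMax, isMin, and, eq, freeFunc,
      Term.freeFunc]
  · ext G
    have hind (β : Assignment G.Node) (u v : G.Node) :
        Sat G circularArrangement ((β.setNode inVar u).setNode outVar v) ↔
          Sat G circularArrangement β := by
      simp only [sat_circularArrangement, Assignment.func_setNode]
    simp only [hamiltonicity, Set.mem_ofPred_eq, sat_and, sat_threeNodes, sat_exFunc hind,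
      sat_circularArrangement, Assignment.func_setFunc_self]
    rw [isHamiltonian_iff (by have := G.two_le; omega)]
    exact ⟨fun h _ => h, fun h => h ⟨fun _ => 0, fun _ => id⟩⟩

end FFL

/-! ### Complete bipartite graphs -/

/-- The complete bipartite graph whose first part consists of the `m` smallest of `n` nodes. -/
def bipartition (n m : ℕ) : SimpleGraph (Fin n) where
  Adj u v := ¬((u : ℕ) < m ↔ (v : ℕ) < m)
  symm := ⟨fun u v h => by rwa [iff_comm]⟩
  loopless := ⟨fun u h => h Iff.rfl⟩

lemma bipartition_connected (m k : ℕ) :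
    (bipartition ((m + 1) + (k + 1)) (m + 1)).Connected := by
  have hadj (u v : Fin ((m + 1) + (k + 1))) (h : ¬((u : ℕ) < m + 1 ↔ (v : ℕ) < m + 1)) :
      (bipartition ((m + 1) + (k + 1)) (m + 1)).Reachable u v :=
    SimpleGraph.Adj.reachable h
  have hzero (u : Fin ((m + 1) + (k + 1))) :
      (bipartition ((m + 1) + (k + 1)) (m + 1)).Reachable u 0 := by
    by_cases hu : (u : ℕ) < m + 1
    · exact (hadj u ⟨m + 1, by omega⟩ (by simp [hu])).trans (hadj _ _ (by simp))
    · exact hadj _ _ (by simp [hu])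
  exact ⟨fun u v => (hzero u).trans (hzero v).symm⟩

/-- The complete bipartite graph with parts `{0, …, m}` and `{m + 1, …, m + 1 + k}`, where all nodes
have the label `a`. -/
def completeBipartite {Λ : Type*} (a : Λ) (m k : ℕ) : LabeledGraph Λ where
  n := (m + 1) + (k + 1)
  two_le := by omega
  graph := bipartition _ (m + 1)
  connected := bipartition_connected m k
  label _ := a

lemma bipartition_isHamiltonian {m : ℕ} (hm : 2 ≤ m) :
    (bipartition (m + m) m).IsHamiltonian := by
  have : NeZero (m + m) := ⟨by omega⟩
  rw [isHamiltonian_iff (by omega)]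
  -- The circle `0, m, 1, m + 1, …` alternates between the parts.
  refine ⟨by omega, fun i => ⟨if (i : ℕ) % 2 = 0 then i / 2 else m + i / 2, by
    have := i.isLt; split_ifs <;> omega⟩, fun i j h => ?_, fun i => ?_⟩
  · have hi := i.isLt
    have hj := j.isLt
    simp only [Fin.mk.injEq] at h
    apply Fin.ext
    split_ifs at h <;> omega
  · have hi := i.isLt
    have h1 : ((i + 1 : Fin (m + m)) : ℕ) = if (i : ℕ) + 1 = m + m then 0 else (i : ℕ) + 1 := by
      rw [Fin.val_add, Fin.val_one', Nat.add_mod_mod]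
      split_ifs with h
      · rw [h, Nat.mod_self]
      · exact Nat.mod_eq_of_lt (by omega)
    simp only [bipartition, h1]
    split_ifs <;> omega

/-- Moving one step along the circle is a permutation `σ` of the nodes that exchanges the two parts,
so they are equally large. -/
lemma eq_of_bipartition_isHamiltonian {m k : ℕ}
    (h : (bipartition ((m + 1) + (k + 1)) (m + 1)).IsHamiltonian) : m = k := by
  rw [isHamiltonian_iff (by omega)] at h
  obtain ⟨-, p, hp, hadj⟩ := h
  let e := Equiv.ofBijective p (Finite.injective_iff_bijective.1 hp)
  let σ : Equiv.Perm (Fin ((m + 1) + (k + 1))) := (e.symm.trans (Equiv.addRight 1)).trans e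
  have hσ (v : Fin ((m + 1) + (k + 1))) : ((v : ℕ) < m + 1) ↔ ¬((σ v : ℕ) < m + 1) := by
    have := hadj (e.symm v)
    have hv : p (e.symm v) = v := e.apply_symm_apply v
    rw [hv] at this
    have hs : σ v = p (e.symm v + 1) := rfl
    rw [hs]
    simp only [bipartition] at this
    tauto
  have hcard := Fintype.card_congr
    (σ.subtypeEquiv (p := fun v : Fin ((m + 1) + (k + 1)) => (v : ℕ) < m + 1)
      (q := fun v : Fin ((m + 1) + (k + 1)) => ¬((v : ℕ) < m + 1)) hσ)
  rw [Fintype.card_subtype_compl, Fintype.card_fin, Fintype.card_subtype] at hcard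
  have : (Finset.univ.filter fun v : Fin ((m + 1) + (k + 1)) => (v : ℕ) < m + 1).card = m + 1 := by
    rw [Fin.card_filter_val_lt]
    omega
  omega

/-! ### Hamiltonicity is not definable in monadic second-order logic -/

namespace MSO

variable {Λ : Type*}

/-- Used for sentences, whose truth under one assignment thus yields truth under all. -/
lemma sat_congr {G : LabeledGraph Λ} (φ : MSO Λ) {ν ν' : NodeVar → G.Node}
    {σ σ' : SetVar → Set G.Node} (hν : Set.EqOn ν ν' φ.freeNode) (hσ : Set.EqOn σ σ' φ.freeSet) :
    φ.Sat G ν σ ↔ φ.Sat G ν' σ' := by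
  induction φ generalizing ν ν' σ σ' with
  | labeled a x => simp [Sat, hν (show x ∈ freeNode (labeled a x) from rfl)]
  | smaller x y =>
    simp [Sat, hν (show x ∈ freeNode (smaller x y) from Or.inl rfl),
      hν (show y ∈ freeNode (smaller x y) from Or.inr rfl)]
  | linked x y =>
    simp [Sat, hν (show x ∈ freeNode (linked x y) from Or.inl rfl),
      hν (show y ∈ freeNode (linked x y) from Or.inr rfl)]
  | mem x X =>
    simp [Sat, hν (show x ∈ freeNode (mem x X) from rfl),
      hσ (show X ∈ freeSet (mem x X) from rfl)]
  | not φ ih => exact not_congr (ih hν hσ)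
  | or φ ψ ih ih' =>
    exact or_congr (ih (hν.mono Set.subset_union_left) (hσ.mono Set.subset_union_left))
      (ih' (hν.mono Set.subset_union_right) (hσ.mono Set.subset_union_right))
  | exNode x φ ih =>
    refine exists_congr fun v => ih (fun y hy => ?_) hσ
    by_cases h : y = x
    · subst h
      simp
    · simpa [h] using hν ⟨hy, h⟩
  | exSet X φ ih =>
    refine exists_congr fun S => ih hν fun Y hY => ?_
    by_cases h : Y = X
    · subst h
      simp
    · simpa [h] using hσ ⟨hY, h⟩

/-- The part of an assignment that concerns the first part of a complete bipartite graph. -/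
structure LeftAssignment where
  /-- the index of the last node of the first part -/
  m : ℕ
  node : NodeVar → Option (Fin (m + 1))
  set : SetVar → Set (Fin (m + 1))

/-- The part of an assignment that concerns the second part of a complete bipartite graph. -/
structure RightAssignment where
  /-- the number of nodes of the second part, minus one -/
  k : ℕ
  -- Relevant only for variables that the left assignment sends to `none`.
  node : NodeVar → Fin (k + 1)
  set : SetVar → Set (Fin (k + 1))

/-! ### Composition: gluing the two parts of a complete bipartite graph -/

namespace LeftAssignment

/-- `l[x ↦ v]`, where `none` stands for a node of the second part. -/
def setNode (l : LeftAssignment) (x : NodeVar) (v : Option (Fin (l.m + 1))) : LeftAssignment :=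
  { l with node := Function.update l.node x v }

/-- `l[X ↦ S]`. -/
def setSet (l : LeftAssignment) (X : SetVar) (S : Set (Fin (l.m + 1))) : LeftAssignment :=
  { l with set := Function.update l.set X S }

/-- The common node assignment. -/
def glueNode (l : LeftAssignment) (r : RightAssignment) (x : NodeVar) :
    Fin ((l.m + 1) + (r.k + 1)) :=
  (l.node x).elim (Fin.natAdd (l.m + 1) (r.node x)) (Fin.castAdd (r.k + 1))

/-- The common set assignment. -/
def glueSet (l : LeftAssignment) (r : RightAssignment) (X : SetVar) :
    Set (Fin ((l.m + 1) + (r.k + 1))) :=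
  Fin.castAdd (r.k + 1) '' l.set X ∪ Fin.natAdd (l.m + 1) '' r.set X

/-- Truth in the glued structure. -/
def Holds (a : Λ) (φ : MSO Λ) (l : LeftAssignment) (r : RightAssignment) : Prop :=
  φ.Sat (completeBipartite a l.m r.k) (l.glueNode r) (l.glueSet r)

/-- A new node lies in one of the two parts; if it lies in the second, the left side records only
`none`. -/
lemma holds_exNode (a : Λ) (x : NodeVar) (φ : MSO Λ) (l : LeftAssignment) (r : RightAssignment) :
    Holds a (exNode x φ) l r ↔ (∃ v, Holds a φ (l.setNode x (some v)) r) ∨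
      ∃ w, Holds a φ (l.setNode x none) { r with node := Function.update r.node x w } := by
  have hl (v) : (l.setNode x (some v)).glueNode r =
      Function.update (l.glueNode r) x (Fin.castAdd (r.k + 1) v) := by
    funext y
    by_cases h : y = x
    · subst h
      simp [glueNode, setNode]
    · simp [glueNode, setNode, h]
  have hr (w) : (l.setNode x none).glueNode { r with node := Function.update r.node x w } =
      Function.update (l.glueNode r) x (Fin.natAdd (l.m + 1) w) := by
    funext y
    by_cases h : y = x
    · subst h
      simp [glueNode, setNode]
    · simp [glueNode, setNode, h]
  constructor
  · rintro ⟨v, hv⟩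
    change Fin ((l.m + 1) + (r.k + 1)) at v
    induction v using Fin.addCases with
    | left v =>
      refine Or.inl ⟨v, ?_⟩
      rw [Holds, hl]
      exact hv
    | right w =>
      refine Or.inr ⟨w, ?_⟩
      rw [Holds, hr]
      exact hv
  · rintro (⟨v, hv⟩ | ⟨w, hw⟩)
    · rw [Holds, hl] at hv
      exact ⟨_, hv⟩
    · rw [Holds, hr] at hw
      exact ⟨_, hw⟩

/-- A set of nodes amounts to its traces on the two parts, which can be chosen independently. -/
lemma holds_exSet (a : Λ) (X : SetVar) (φ : MSO Λ) (l : LeftAssignment) (r : RightAssignment) :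
    Holds a (exSet X φ) l r ↔
      ∃ S T, Holds a φ (l.setSet X S) { r with set := Function.update r.set X T } := by
  have key (S T) : (l.setSet X S).glueSet { r with set := Function.update r.set X T } =
      Function.update (l.glueSet r) X
        (Fin.castAdd (r.k + 1) '' S ∪ Fin.natAdd (l.m + 1) '' T) := by
    funext Y
    by_cases h : Y = X
    · subst h
      simp [glueSet, setSet]
      rfl
    · simp [glueSet, setSet, h]
      rfl
  constructor
  · rintro ⟨U, hU⟩
    change Set (Fin ((l.m + 1) + (r.k + 1))) at U
    refine ⟨Fin.castAdd (r.k + 1) ⁻¹' U, Fin.natAdd (l.m + 1) ⁻¹' U, ?_⟩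
    have hU' : Fin.castAdd (r.k + 1) '' (Fin.castAdd (r.k + 1) ⁻¹' U) ∪
        Fin.natAdd (l.m + 1) '' (Fin.natAdd (l.m + 1) ⁻¹' U) = U := by
      ext v
      induction v using Fin.addCases with
      | left v => simpa using fun x hx e => e ▸ hx
      | right w => simpa using fun x hx e => e ▸ hx
    rw [Holds, key, hU']
    exact hU
  · rintro ⟨S, T, h⟩
    rw [Holds, key] at h
    exact ⟨_, h⟩

/-- The first part influences the truth of a formula only through its type, one of finitely many. -/
lemma exists_finite_type (a : Λ) (φ : MSO Λ) :
    ∃ (T : Type) (_ : Finite T) (τ : LeftAssignment → T),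
      ∀ l l', τ l = τ l' → ∀ r, Holds a φ l r ↔ Holds a φ l' r := by
  induction φ with
  -- All nodes carry the label `a`, so nothing about `l` matters.
  | labeled b x => exact ⟨Unit, inferInstance, fun _ => (), fun l l' _ r => Iff.rfl⟩
  | smaller x y =>
    -- The first part precedes the second, so positions within the first part matter only when both
    -- nodes lie there.
    refine ⟨Prop × Prop × Prop, inferInstance, fun l => (l.node x = none, l.node y = none,
      ∃ u ∈ l.node x, ∃ v ∈ l.node y, (u : ℕ) < v), fun l l' h r => ?_⟩
    have key (l : LeftAssignment) : Holds a (smaller x y) l r ↔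
        (l.node x = none ∧ l.node y = none ∧ (r.node x : ℕ) < r.node y) ∨
        (l.node x ≠ none ∧ l.node y = none) ∨ ∃ u ∈ l.node x, ∃ v ∈ l.node y, (u : ℕ) < v := by
      change (l.glueNode r x : ℕ) < l.glueNode r y ↔ _
      rcases hx : l.node x with _ | u <;> rcases hy : l.node y with _ | v <;>
        simp [glueNode, hx, hy] <;> omega
    simp only [Prod.mk.injEq] at h
    rw [key, key, ne_eq, ne_eq, h.1, h.2.1, h.2.2]
  | linked x y =>
    -- Adjacency depends only on the parts in which the nodes lie.
    refine ⟨Prop × Prop, inferInstance, fun l => (l.node x = none, l.node y = none),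
      fun l l' h r => ?_⟩
    have key (l : LeftAssignment) : Holds a (linked x y) l r ↔
        ¬(l.node x = none ↔ l.node y = none) := by
      change ¬((l.glueNode r x : ℕ) < l.m + 1 ↔ (l.glueNode r y : ℕ) < l.m + 1) ↔ _
      rcases hx : l.node x with _ | u <;> rcases hy : l.node y with _ | v <;>
        simp [glueNode, hx, hy] <;> omega
    simp only [Prod.mk.injEq] at h
    rw [key, key, h.1, h.2]
  | mem x X =>
    refine ⟨Prop × Prop, inferInstance, fun l => (l.node x = none, ∃ u ∈ l.node x, u ∈ l.set X),
      fun l l' h r => ?_⟩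
    have key (l : LeftAssignment) : Holds a (mem x X) l r ↔
        (l.node x = none ∧ r.node x ∈ r.set X) ∨ ∃ u ∈ l.node x, u ∈ l.set X := by
      change l.glueNode r x ∈ l.glueSet r X ↔ _
      rcases hx : l.node x with _ | u <;>
        simp [glueNode, glueSet, hx] <;> intro v _ e <;> have := congrArg Fin.val e <;>
        simp at this <;> omega
    simp only [Prod.mk.injEq] at h
    rw [key, key, h.1, h.2]
  | not φ ih =>
    obtain ⟨T, hT, τ, h⟩ := ih
    exact ⟨T, hT, τ, fun l l' e r => not_congr (h l l' e r)⟩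
  | or φ ψ ih ih' =>
    obtain ⟨T, hT, τ, h⟩ := ih
    obtain ⟨T', hT', τ', h'⟩ := ih'
    refine ⟨T × T', inferInstance, fun l => (τ l, τ' l), fun l l' e r => ?_⟩
    rw [Prod.mk.injEq] at e
    exact or_congr (h l l' e.1 r) (h' l l' e.2 r)
  | exNode x φ ih =>
    obtain ⟨T, hT, τ, h⟩ := ih
    -- The type records which types for `φ` a choice of `x` can achieve. A choice in `l` is answered
    -- by a choice in `l'` of the same type, even if the sizes differ.
    refine ⟨Set T × T, inferInstance,
      fun l => (Set.range fun v => τ (l.setNode x (some v)), τ (l.setNode x none)), ?_⟩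
    have key (l l' : LeftAssignment) (e : (Set.range fun v => τ (l.setNode x (some v))) =
        Set.range fun v => τ (l'.setNode x (some v)))
        (e' : τ (l.setNode x none) = τ (l'.setNode x none)) (r : RightAssignment)
        (hl : Holds a (exNode x φ) l r) : Holds a (exNode x φ) l' r := by
      rw [holds_exNode] at hl ⊢
      rcases hl with ⟨v, hv⟩ | ⟨w, hw⟩
      · obtain ⟨v', hv'⟩ := e.subset ⟨v, rfl⟩
        exact Or.inl ⟨v', (h _ _ hv' r).2 hv⟩
      · exact Or.inr ⟨w, (h _ _ e' _).1 hw⟩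
    intro l l' e r
    rw [Prod.mk.injEq] at e
    exact ⟨key l l' e.1 e.2 r, key l' l e.1.symm e.2.symm r⟩
  | exSet X φ ih =>
    obtain ⟨T, hT, τ, h⟩ := ih
    refine ⟨Set T, inferInstance, fun l => Set.range fun S => τ (l.setSet X S), ?_⟩
    have key (l l' : LeftAssignment) (e : (Set.range fun S => τ (l.setSet X S)) =
        Set.range fun S => τ (l'.setSet X S)) (r : RightAssignment)
        (hl : Holds a (exSet X φ) l r) : Holds a (exSet X φ) l' r := by
      rw [holds_exSet] at hl ⊢
      obtain ⟨S, U, hS⟩ := hl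
      obtain ⟨S', hS'⟩ := e.subset ⟨S, rfl⟩
      exact ⟨S', U, (h _ _ hS' _).2 hS⟩
    exact fun l l' e r => ⟨key l l' e r, key l' l e.symm r⟩

end LeftAssignment

lemma not_definable_hamiltonicity [Nonempty Λ] : ¬ Definable (hamiltonicity Λ) := by
  rintro ⟨φ, ⟨hn, hs⟩, hP⟩
  obtain ⟨a⟩ := ‹Nonempty Λ›
  have hmem (l : LeftAssignment) (r : RightAssignment) :
      completeBipartite a l.m r.k ∈ hamiltonicity Λ ↔ LeftAssignment.Holds a φ l r := by
    rw [hP]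
    exact ⟨fun h => h _ _, fun h ν σ =>
      (φ.sat_congr (by rw [hn]; exact Set.eqOn_empty _ _) (by rw [hs]; exact Set.eqOn_empty _ _)).1 h⟩
  obtain ⟨T, hT, τ, h⟩ := LeftAssignment.exists_finite_type a φ
  -- Pigeonhole on first parts with `m + 2` nodes; two nodes at least are needed for a cycle in the
  -- balanced graph.
  obtain ⟨m, m', hne, e⟩ := Finite.exists_ne_map_eq_of_infinite
    fun m : ℕ => τ ⟨m + 1, fun _ => none, fun _ => ∅⟩
  -- The second part is as large as the first part for `m`, so that the graph for `m` is balanced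
  -- and the one for `m'` is not.
  have hr := h _ _ e ⟨m + 1, fun _ => 0, fun _ => ∅⟩
  rw [← hmem, ← hmem] at hr
  have := eq_of_bipartition_isHamiltonian
    (hr.1 (bipartition_isHamiltonian (m := m + 1 + 1) (by omega)))
  exact hne (Nat.succ_injective this).symm

end MSO

end FunctionalFixpoint

theorem mainTheorem2 (Λ : Type*) [Finite Λ] [Nonempty Λ] :
    {P : Set (FunctionalFixpoint.LabeledGraph Λ) | FunctionalFixpoint.MSO.Definable P} ⊂
        {P : Set (FunctionalFixpoint.LabeledGraph Λ) | FunctionalFixpoint.FFL.Definable P} ∧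
      FunctionalFixpoint.FFL.Definable (FunctionalFixpoint.hamiltonicity Λ) ∧
      ¬ FunctionalFixpoint.MSO.Definable (FunctionalFixpoint.hamiltonicity Λ) :=
  ⟨⟨fun _ hP => hP.ffl, fun h => FunctionalFixpoint.MSO.not_definable_hamiltonicity
      (h FunctionalFixpoint.FFL.definable_hamiltonicity)⟩,
    FunctionalFixpoint.FFL.definable_hamiltonicity,
    FunctionalFixpoint.MSO.not_definable_hamiltonicity⟩
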